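/- Let $d,m\ge 0$ be integers and $1<p<2$; norms of vectors are Euclidean, norms of matrices are the induced operator norms, and $|A|$ is the operator norm of $A$. For a path $z$ and $a\le b$ let $|||z|||_{p\text{-var},[a,b]}=\big(\sup\sum_i\|z_{t_{i+1}}-z_{t_i}\|^p\big)^{1/p}$, the supremum being over the finite partitions $(t_i)$ of $[a,b]$, and $\|z\|_{p\text{-var},[a,b]}=\|z_a\|+|||z|||_{p\text{-var},[a,b]}$. Let $A\in\mathbb R^{d\times d}$ and let $C_A\ge 1$, $\lambda_A>0$ be constants such that $\Phi(t)=e^{At}$ satisfies $\|\Phi(t)\|\le C_Ae^{-\lambda_At}$ for all $t\ge0$ (such constants exist exactly when all eigenvalues of $A$ have negative real parts). Let $f:\mathbb R^d\to\mathbb R^d$ and $g:\mathbb R^d\to\mathbb R^{d\times m}$ be globally Lipschitz continuous with Lipschitz constants $C_f$ and $C_g$. Let $x:\mathbb R\to\mathbb R^m$ be continuous with finite $p$-variation on every compact interval, and let $y:[0,\infty)\to\mathbb R^d$ be continuous with finite $p$-variation on every compact interval in $[0,\infty)$, such that $$y_t=\Phi(t)y_0+\int_0^t\Phi(t-s)f(y_s)\,ds+\int_0^t\Phi(t-s)g(y_s)\,dx_s\qquad\text{for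 all } t\ge0,$$ where the last integral is a Young integral, $\int_0^t Y_s\,dx_s=\lim_{|\Pi|\to0}\sum_{[u,v]\in\Pi}Y_u(x_v-x_u)$ over the finite partitions $\Pi$ of $[0,t]$. Put $L_f=C_AC_f$, $\lambda=\lambda_A-L_f$, $K=(1-2^{1-2/p})^{-1}$ and $\Delta_k=[k,k+1]$, and assume $\lambda\ne0$. Then for every integer $n\ge0$ and every $t\in\Delta_n$, $$\|y_t\|e^{\lambda t}\le C_A\|y_0\|+\frac{C_A}{\lambda_A-L_f}\|f(0)\|\big(e^{\lambda t}-1\big)+\sum_{k=0}^{n}e^{\lambda_A}KC_A(1+|A|)\,|||x|||_{p\text{-var},\Delta_k}\,e^{\lambda k}\Big[C_g\|y\|_{p\text{-var},\Delta_k}+\|g(0)\|\Big].$$ -/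

import Mathlib

open scoped NNReal

/-- The real numbers `τ 0 ≤ τ 1 ≤ ⋯ ≤ τ n` form a finite partition of `[a, b]`. Repeated points are
allowed; they contribute zero to all the sums below. -/
structure IsPartition (a b : ℝ) (n : ℕ) (τ : ℕ → ℝ) : Prop where
  left : τ 0 = a
  right : τ n = b
  mono : ∀ i < n, τ i ≤ τ (i + 1)

section PVariation

variable {E : Type*} [NormedAddCommGroup E]

/-- The set of all sums `∑ ‖x (τ (i+1)) - x (τ i)‖ ^ p` over the finite partitions of `[a, b]`. -/
def pVarSums (p : ℝ) (x : ℝ → E) (a b : ℝ) : Set ℝ :=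
  {S | ∃ (n : ℕ) (τ : ℕ → ℝ), IsPartition a b n τ ∧
    S = ∑ i ∈ Finset.range n, ‖x (τ (i + 1)) - x (τ i)‖ ^ p}

/-- The `p`-variation seminorm of `x` on `[a, b]` (meaningful if `pVarSums p x a b` is bounded). -/
noncomputable def pVar (p : ℝ) (x : ℝ → E) (a b : ℝ) : ℝ :=
  sSup (pVarSums p x a b) ^ (1 / p)

/-- The `p`-variation norm of `x` on `[a, b]`. -/
noncomputable def pVarNorm (p : ℝ) (x : ℝ → E) (a b : ℝ) : ℝ :=
  ‖x a‖ + pVar p x a b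

/-- `x` is a continuous path on the interval `s ⊆ ℝ` that has finite `p`-variation on every compact
interval `[a, b] ⊆ s`. -/
structure IsPVarPath (p : ℝ) (s : Set ℝ) (x : ℝ → E) : Prop where
  continuousOn : ContinuousOn x s
  finite_pVar : ∀ a b : ℝ, a ≤ b → Set.Icc a b ⊆ s → BddAbove (pVarSums p x a b)

end PVariation

section YoungIntegral

variable {E F : Type*} [NormedAddCommGroup E] [NormedSpace ℝ E]
  [NormedAddCommGroup F] [NormedSpace ℝ F]

/-- The left-point Riemann–Stieltjes sums of `Y` against `x` over the finite partitions of `[a, b]`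
converge to `I` as the mesh of the partition tends to zero. -/
def HasYoungIntegral (Y : ℝ → E →L[ℝ] F) (x : ℝ → E) (a b : ℝ) (I : F) : Prop :=
  ∀ ε > 0, ∃ δ > 0, ∀ (n : ℕ) (τ : ℕ → ℝ), IsPartition a b n τ →
    (∀ i < n, τ (i + 1) - τ i < δ) →
      ‖(∑ i ∈ Finset.range n, Y (τ i) (x (τ (i + 1)) - x (τ i))) - I‖ < ε

open Classical in
/-- The Young integral `∫_a^b Y_s dx_s` for `a ≤ b`: the limit of the left-point sums
(and `0` if there is no limit). -/
noncomputable def youngIntegral (Y : ℝ → E →L[ℝ] F) (x : ℝ → E) (a b : ℝ) : F :=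
  if h : ∃ I : F, HasYoungIntegral Y x a b I then h.choose else 0

end YoungIntegral

/-- The semigroup `Φ(t) = e^{At}` generated by the linear operator (matrix) `A`. -/
noncomputable def semigroup {d : ℕ}
    (A : EuclideanSpace ℝ (Fin d) →L[ℝ] EuclideanSpace ℝ (Fin d)) (t : ℝ) :
    EuclideanSpace ℝ (Fin d) →L[ℝ] EuclideanSpace ℝ (Fin d) :=
  NormedSpace.exp (t • A)

/-- The variation-of-constants formula
`y_t = Φ(t) y_0 + ∫_0^t Φ(t-s) f(y_s) ds + ∫_0^t Φ(t-s) g(y_s) dx_s` for all `t ≥ 0`. -/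
def SatisfiesVariationOfConstants {d m : ℕ}
    (A : EuclideanSpace ℝ (Fin d) →L[ℝ] EuclideanSpace ℝ (Fin d))
    (f : EuclideanSpace ℝ (Fin d) → EuclideanSpace ℝ (Fin d))
    (g : EuclideanSpace ℝ (Fin d) → EuclideanSpace ℝ (Fin m) →L[ℝ] EuclideanSpace ℝ (Fin d))
    (x : ℝ → EuclideanSpace ℝ (Fin m)) (y : ℝ → EuclideanSpace ℝ (Fin d)) : Prop :=
  ∀ t : ℝ, 0 ≤ t →
    y t = semigroup A t (y 0) + (∫ s in (0 : ℝ)..t, semigroup A (t - s) (f (y s)))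
      + youngIntegral (fun s => (semigroup A (t - s)).comp (g (y s))) x 0 t

/-- The constant `K = (1 - 2^{1 - 2/p})⁻¹` of the Young–Loève estimate. -/
noncomputable def youngConst (p : ℝ) : ℝ := (1 - (2 : ℝ) ^ (1 - 2 / p))⁻¹

/-! Multiply the variation-of-constants formula by `e^{λ_A t}`. The first term is at most
`C_A‖y_0‖`, the drift term is at most the integral of `C_A‖f(0)‖e^{λ_A s} + L_f‖y_s‖e^{λ_A s}`, and
the Young integral contributes one summand `c k` for each unit interval met so far. A Gronwall
argument with these jumps turns the rate `λ_A` into `λ_A - L_f` (`mul_exp_neg_le_of_le_integral`).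

The summands come from a Young–Loève estimate with the constant `K` (`hasFineSumsLE_of_pVar`). It is
proved by sewing: the `p`-th powers of the `p`-variations are superadditive and continuous at the
endpoints, so an interval can be cut where a control at most halves on both sides. Iterating this
yields arbitrarily fine partitions, and the errors form a geometric series of ratio `2^{1-2/p}`.
Only a bound on the integral is needed, so bounding the sums along some partitions of vanishing mesh
suffices; neither existence nor additivity of the Young integral enters. -/

open Filter Topology

/-! ### Partition sums, built by concatenation -/

/-- `S` is the sum of `φ u v` over the consecutive points `u ≤ v` of a finite partition of `[a, b]`
all of whose consecutive points satisfy `R u v`. -/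
inductive PartitionSum {G : Type*} [AddCommMonoid G] (φ : ℝ → ℝ → G) (R : ℝ → ℝ → Prop) :
    ℝ → ℝ → G → Prop
  | nil (a : ℝ) : PartitionSum φ R a a 0
  | single {a b : ℝ} (hab : a ≤ b) (hR : R a b) : PartitionSum φ R a b (φ a b)
  | trans {a b c : ℝ} {S T : G} (hS : PartitionSum φ R a b S) (hT : PartitionSum φ R b c T) :
      PartitionSum φ R a c (S + T)

namespace PartitionSum

section Basic

variable {G : Type*} [AddCommMonoid G] {φ : ℝ → ℝ → G} {R : ℝ → ℝ → Prop} {a b : ℝ} {S : G}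

theorem le (h : PartitionSum φ R a b S) : a ≤ b := by
  induction h with
  | nil => exact le_rfl
  | single hab => exact hab
  | trans _ _ h₁ h₂ => exact h₁.trans h₂

theorem exists_isPartition (h : PartitionSum φ R a b S) :
    ∃ (n : ℕ) (τ : ℕ → ℝ), IsPartition a b n τ ∧ (∀ i < n, R (τ i) (τ (i + 1))) ∧
      S = ∑ i ∈ Finset.range n, φ (τ i) (τ (i + 1)) := by
  induction h with
  | nil a => exact ⟨0, fun _ => a, ⟨rfl, rfl, by simp⟩, by simp, by simp⟩
  | @single a b hab hR =>
    refine ⟨1, fun i => if i = 0 then a else b, ⟨by simp, by simp, ?_⟩, ?_, by simp⟩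
    · intro i hi
      obtain rfl : i = 0 := by omega
      simpa using hab
    · intro i hi
      obtain rfl : i = 0 := by omega
      simpa using hR
  | @trans a b c S T _ _ h₁ h₂ =>
    obtain ⟨n, τ, hτ, hRτ, rfl⟩ := h₁
    obtain ⟨k, σ, hσ, hRσ, rfl⟩ := h₂
    -- Stated for an arbitrary relation, so that it serves both for `≤` and for `R`. The two
    -- branches meet at index `n`, where `τ n = σ 0`.
    have key : ∀ P : ℝ → ℝ → Prop, (∀ i < n, P (τ i) (τ (i + 1))) →
        (∀ i < k, P (σ i) (σ (i + 1))) → ∀ i < n + k,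
          P (if i ≤ n then τ i else σ (i - n)) (if i + 1 ≤ n then τ (i + 1) else σ (i + 1 - n)) := by
      intro P h₁ h₂ i hi
      rcases lt_trichotomy i n with h | h | h
      · rw [if_pos h.le, if_pos (by omega)]
        exact h₁ i h
      · subst h
        rw [if_pos le_rfl, if_neg (by omega), hτ.right, ← hσ.left]
        have := h₂ 0 (by omega)
        simpa using this
      · rw [if_neg (by omega), if_neg (by omega), show i + 1 - n = i - n + 1 by omega]
        exact h₂ (i - n) (by omega)
    refine ⟨n + k, fun i => if i ≤ n then τ i else σ (i - n), ⟨?_, ?_, ?_⟩, ?_, ?_⟩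
    · simpa using hτ.left
    · rcases Nat.eq_zero_or_pos k with rfl | hk
      · simp [hτ.right, ← hσ.right, hσ.left]
      · simp [hk.ne', hσ.right]
    · exact key (· ≤ ·) hτ.mono hσ.mono
    · exact key R hRτ hRσ
    · rw [Finset.sum_range_add]
      congr 1
      · refine Finset.sum_congr rfl fun i hi => ?_
        have := Finset.mem_range.1 hi
        dsimp only
        rw [if_pos (by omega), if_pos (by omega)]
      · refine Finset.sum_congr rfl fun i _ => ?_
        dsimp only
        rw [if_neg (by omega : ¬ n + i + 1 ≤ n), show n + i + 1 - n = i + 1 by omega]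
        by_cases hi : i = 0
        · subst hi
          simp [hτ.right, hσ.left]
        · rw [if_neg (by omega), show n + i - n = i by omega]

theorem of_isPartition {n : ℕ} {τ : ℕ → ℝ} (hτ : IsPartition a b n τ)
    (hR : ∀ i < n, R (τ i) (τ (i + 1))) :
    PartitionSum φ R a b (∑ i ∈ Finset.range n, φ (τ i) (τ (i + 1))) := by
  have : ∀ j ≤ n, PartitionSum φ R (τ 0) (τ j) (∑ i ∈ Finset.range j, φ (τ i) (τ (i + 1))) := by
    intro j
    induction j with
    | zero => exact fun _ => by simpa using nil (τ 0)
    | succ j ih =>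
      intro hj
      rw [Finset.sum_range_succ]
      exact (ih (by omega)).trans (single (hτ.mono j hj) (hR j hj))
  simpa [hτ.left, hτ.right] using this n le_rfl

theorem eq_zero_of_eq (hφ : ∀ u, φ u u = 0) (h : PartitionSum φ R a b S) (hab : a = b) :
    S = 0 := by
  induction h with
  | nil => rfl
  | @single a b _ _ => subst hab; exact hφ a
  | @trans a b c S T h₁ h₂ ih₁ ih₂ =>
    subst hab
    have : a = b := le_antisymm h₁.le h₂.le
    rw [ih₁ this, ih₂ this.symm, add_zero]

end Basic

section Limits

variable {φ : ℝ → ℝ → ℝ} {R : ℝ → ℝ → Prop} {s t a b S : ℝ}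

/-- Lower semicontinuity in the right endpoint: only the last nondegenerate interval has to be
shortened, and its term changes continuously. Degenerate intervals are discarded, which is why `φ`
must vanish on them. -/
theorem eventually_left (hR : ∀ u v, R u v) (hφ : ∀ u, φ u u = 0) (hs : a ≤ s) (ht : t ≤ b)
    (hlim : ∀ u v, a ≤ u → u < v → v ≤ b → Tendsto (φ u) (𝓝[<] v) (𝓝 (φ u v)))
    (h : PartitionSum φ R s t S) (hst : s < t) {c : ℝ} (hc : c < S) :
    ∀ᶠ u in 𝓝[<] t, ∃ T, c < T ∧ PartitionSum φ R s u T := by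
  induction h generalizing c with
  | nil => exact absurd hst (lt_irrefl _)
  | @single s t _ _ =>
    filter_upwards [(hlim s t hs hst ht).eventually_const_lt hc, Ioo_mem_nhdsLT hst] with u hu hu'
    exact ⟨_, hu, single hu'.1.le (hR _ _)⟩
  | @trans s m t S T h₁ h₂ ih₁ ih₂ =>
    rcases h₂.le.eq_or_lt with rfl | hmt
    · rw [h₂.eq_zero_of_eq hφ rfl, add_zero] at hc
      exact ih₁ hs ht hst hc
    · filter_upwards [ih₂ (hs.trans h₁.le) ht hmt (c := c - S) (by linarith)] with u hu
      obtain ⟨T', hT', h⟩ := hu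
      exact ⟨S + T', by linarith, h₁.trans h⟩

theorem eventually_right (hR : ∀ u v, R u v) (hφ : ∀ u, φ u u = 0) (hs : a ≤ s) (ht : t ≤ b)
    (hlim : ∀ u v, a ≤ u → u < v → v ≤ b → Tendsto (φ · v) (𝓝[>] u) (𝓝 (φ u v)))
    (h : PartitionSum φ R s t S) (hst : s < t) {c : ℝ} (hc : c < S) :
    ∀ᶠ u in 𝓝[>] s, ∃ T, c < T ∧ PartitionSum φ R u t T := by
  induction h generalizing c with
  | nil => exact absurd hst (lt_irrefl _)
  | @single s t _ _ =>
    filter_upwards [(hlim s t hs hst ht).eventually_const_lt hc, Ioo_mem_nhdsGT hst] with u hu hu'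
    exact ⟨_, hu, single hu'.2.le (hR _ _)⟩
  | @trans s m t S T h₁ h₂ ih₁ ih₂ =>
    rcases h₁.le.eq_or_lt with rfl | hsm
    · rw [h₁.eq_zero_of_eq hφ rfl, zero_add] at hc
      exact ih₂ hs ht hst hc
    · filter_upwards [ih₁ hs (h₂.le.trans ht) hsm (c := c - T) (by linarith)] with u hu
      obtain ⟨T', hT', h⟩ := hu
      exact ⟨T' + T, by linarith, h.trans h₂⟩

end Limits

end PartitionSum

/-! ### Superadditivity and endpoint continuity of the `p`-variation -/

section PVariation

variable {E : Type*} [NormedAddCommGroup E] {p : ℝ} {x : ℝ → E} {a b s t u : ℝ}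

theorem mem_pVarSums_iff {S : ℝ} : S ∈ pVarSums p x a b ↔
    PartitionSum (fun u v => ‖x v - x u‖ ^ p) (fun _ _ => True) a b S := by
  constructor
  · rintro ⟨n, τ, hτ, rfl⟩
    exact PartitionSum.of_isPartition (φ := fun u v => ‖x v - x u‖ ^ p) hτ (by simp)
  · intro h
    obtain ⟨n, τ, hτ, -, rfl⟩ := h.exists_isPartition
    exact ⟨n, τ, hτ, rfl⟩

theorem norm_rpow_mem_pVarSums (hab : a ≤ b) : ‖x b - x a‖ ^ p ∈ pVarSums p x a b :=
  mem_pVarSums_iff.2 (PartitionSum.single (φ := fun u v => ‖x v - x u‖ ^ p) hab trivial)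

theorem pVarSums_nonempty (hab : a ≤ b) : (pVarSums p x a b).Nonempty :=
  ⟨_, norm_rpow_mem_pVarSums hab⟩

theorem add_mem_pVarSums {S T : ℝ} (hS : S ∈ pVarSums p x a b) (hT : T ∈ pVarSums p x b t) :
    S + T ∈ pVarSums p x a t :=
  mem_pVarSums_iff.2 ((mem_pVarSums_iff.1 hS).trans (mem_pVarSums_iff.1 hT))

theorem nonneg_of_mem_pVarSums {S : ℝ} (hS : S ∈ pVarSums p x a b) : 0 ≤ S := by
  obtain ⟨n, τ, -, rfl⟩ := hS
  positivity

theorem sSup_pVarSums_nonneg : 0 ≤ sSup (pVarSums p x a b) :=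
  Real.sSup_nonneg fun _ h => nonneg_of_mem_pVarSums h

theorem pVar_nonneg : 0 ≤ pVar p x a b := Real.rpow_nonneg sSup_pVarSums_nonneg _

theorem bddAbove_pVarSums_mono (h : BddAbove (pVarSums p x a b)) (has : a ≤ s) (htb : t ≤ b) :
    BddAbove (pVarSums p x s t) := by
  obtain ⟨M, hM⟩ := h
  refine ⟨M, fun S hS => ?_⟩
  have h₁ := norm_rpow_mem_pVarSums (p := p) (x := x) has
  have h₂ := norm_rpow_mem_pVarSums (p := p) (x := x) htb
  have := hM (add_mem_pVarSums (add_mem_pVarSums h₁ hS) h₂)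
  linarith [nonneg_of_mem_pVarSums h₁, nonneg_of_mem_pVarSums h₂]

theorem sSup_pVarSums_add_le (h : BddAbove (pVarSums p x a b)) (has : a ≤ s) (hsu : s ≤ u)
    (hut : u ≤ t) (htb : t ≤ b) :
    sSup (pVarSums p x s u) + sSup (pVarSums p x u t) ≤ sSup (pVarSums p x s t) := by
  have hb := bddAbove_pVarSums_mono h has htb
  have : sSup (pVarSums p x s u) ≤ sSup (pVarSums p x s t) - sSup (pVarSums p x u t) := by
    refine csSup_le (pVarSums_nonempty hsu) fun S hS => ?_
    have : sSup (pVarSums p x u t) ≤ sSup (pVarSums p x s t) - S := by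
      refine csSup_le (pVarSums_nonempty hut) fun T hT => ?_
      linarith [le_csSup hb (add_mem_pVarSums hS hT)]
    linarith
  linarith

theorem sSup_pVarSums_mono (h : BddAbove (pVarSums p x a b)) (has : a ≤ s) (hst : s ≤ t)
    (htb : t ≤ b) : sSup (pVarSums p x s t) ≤ sSup (pVarSums p x a b) := by
  have h₁ := sSup_pVarSums_add_le h le_rfl has (hst.trans htb) le_rfl
  have h₂ := sSup_pVarSums_add_le h has hst htb le_rfl
  linarith [sSup_pVarSums_nonneg (p := p) (x := x) (a := a) (b := s),
    sSup_pVarSums_nonneg (p := p) (x := x) (a := t) (b := b)]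

theorem pVar_mono (hp : 0 < p) (h : BddAbove (pVarSums p x a b)) (has : a ≤ s) (hst : s ≤ t)
    (htb : t ≤ b) : pVar p x s t ≤ pVar p x a b :=
  Real.rpow_le_rpow sSup_pVarSums_nonneg (sSup_pVarSums_mono h has hst htb) (by positivity)

theorem norm_sub_le_pVar (hp : 0 < p) (h : BddAbove (pVarSums p x a b)) (hab : a ≤ b) :
    ‖x b - x a‖ ≤ pVar p x a b := by
  have := Real.rpow_le_rpow (by positivity) (le_csSup h (norm_rpow_mem_pVarSums hab))
    (by positivity : 0 ≤ 1 / p)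
  rwa [← Real.rpow_mul (norm_nonneg _), mul_one_div_cancel hp.ne', Real.rpow_one] at this

theorem norm_le_pVarNorm (hp : 0 < p) (h : BddAbove (pVarSums p x a b)) (hat : a ≤ t)
    (htb : t ≤ b) : ‖x t‖ ≤ pVarNorm p x a b := by
  have h₁ := (norm_sub_le_pVar hp (bddAbove_pVarSums_mono h le_rfl htb) hat).trans
    (pVar_mono hp h le_rfl hat htb)
  have h₂ := norm_add_le (x a) (x t - x a)
  rw [add_sub_cancel] at h₂
  unfold pVarNorm
  linarith

/-- Monotonicity gives the upper bound. For the lower one, a partition sum exceeding `c` still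
exceeds `c` after `t` is moved slightly to the left. -/
theorem tendsto_sSup_pVarSums_left (hp : 0 < p) (h : BddAbove (pVarSums p x a b))
    (hx : ContinuousOn x (Set.Icc a b)) (has : a ≤ s) (hst : s < t) (htb : t ≤ b) :
    Tendsto (fun u => sSup (pVarSums p x s u)) (𝓝[<] t) (𝓝 (sSup (pVarSums p x s t))) := by
  refine tendsto_order.2 ⟨fun c hc => ?_, fun c hc => ?_⟩
  · obtain ⟨S, hS, hcS⟩ := exists_lt_of_lt_csSup (pVarSums_nonempty hst.le) hc
    have := (mem_pVarSums_iff.1 hS).eventually_left (by simp) (by simp [hp.ne']) has htb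
      (fun u v hau huv hvb => ?_) hst hcS
    · filter_upwards [this, Ioo_mem_nhdsLT hst] with u ⟨T, hcT, hT⟩ hu
      exact hcT.trans_le (le_csSup (bddAbove_pVarSums_mono h has (hu.2.le.trans htb))
        (mem_pVarSums_iff.2 hT))
    · have hxv : Tendsto x (𝓝[<] v) (𝓝 (x v)) :=
        (hx v ⟨hau.trans huv.le, hvb⟩).mono_left (nhdsWithin_le_of_mem
          (mem_of_superset (Ioo_mem_nhdsLT huv) fun w hw =>
            ⟨hau.trans hw.1.le, hw.2.le.trans hvb⟩))
      exact (hxv.sub_const _).norm.rpow_const (Or.inr hp.le)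
  · filter_upwards [Ioo_mem_nhdsLT hst] with u hu
    exact (sSup_pVarSums_mono (bddAbove_pVarSums_mono h has htb) le_rfl hu.1.le hu.2.le).trans_lt hc

theorem tendsto_sSup_pVarSums_right (hp : 0 < p) (h : BddAbove (pVarSums p x a b))
    (hx : ContinuousOn x (Set.Icc a b)) (has : a ≤ s) (hst : s < t) (htb : t ≤ b) :
    Tendsto (fun u => sSup (pVarSums p x u t)) (𝓝[>] s) (𝓝 (sSup (pVarSums p x s t))) := by
  refine tendsto_order.2 ⟨fun c hc => ?_, fun c hc => ?_⟩
  · obtain ⟨S, hS, hcS⟩ := exists_lt_of_lt_csSup (pVarSums_nonempty hst.le) hc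
    have := (mem_pVarSums_iff.1 hS).eventually_right (by simp) (by simp [hp.ne']) has htb
      (fun u v hau huv hvb => ?_) hst hcS
    · filter_upwards [this, Ioo_mem_nhdsGT hst] with u ⟨T, hcT, hT⟩ hu
      exact hcT.trans_le (le_csSup (bddAbove_pVarSums_mono h (has.trans hu.1.le) htb)
        (mem_pVarSums_iff.2 hT))
    · have hxu : Tendsto x (𝓝[>] u) (𝓝 (x u)) :=
        (hx u ⟨hau, huv.le.trans hvb⟩).mono_left (nhdsWithin_le_of_mem
          (mem_of_superset (Ioo_mem_nhdsGT huv) fun w hw =>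
            ⟨hau.trans hw.1.le, hw.2.le.trans hvb⟩))
      exact (hxu.const_sub _).norm.rpow_const (Or.inr hp.le)
  · filter_upwards [Ioo_mem_nhdsGT hst] with u hu
    exact (sSup_pVarSums_mono (bddAbove_pVarSums_mono h has htb) hu.1.le hu.2.le le_rfl).trans_lt hc

end PVariation

/-! ### Controls and the sewing estimate -/

/-- A nonnegative superadditive function of the subintervals of `[a, b]` whose value on `[s, t]` is
the limit of its values on `[s, u]` as `u ↑ t`, and on `[u, t]` as `u ↓ s`. -/
structure IsControl (ω : ℝ → ℝ → ℝ) (a b : ℝ) : Prop where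
  nonneg : ∀ s t, a ≤ s → s ≤ t → t ≤ b → 0 ≤ ω s t
  add_le : ∀ s u t, a ≤ s → s ≤ u → u ≤ t → t ≤ b → ω s u + ω u t ≤ ω s t
  tendsto_left : ∀ s t, a ≤ s → s < t → t ≤ b → Tendsto (fun u => ω s u) (𝓝[<] t) (𝓝 (ω s t))
  tendsto_right : ∀ s t, a ≤ s → s < t → t ≤ b → Tendsto (fun u => ω u t) (𝓝[>] s) (𝓝 (ω s t))

namespace IsControl

variable {ω ω' : ℝ → ℝ → ℝ} {a b s t : ℝ}

theorem self_eq_zero (h : IsControl ω a b) (has : a ≤ s) (hsb : s ≤ b) : ω s s = 0 :=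
  le_antisymm (by linarith [h.add_le s s s has le_rfl le_rfl hsb]) (h.nonneg s s has le_rfl hsb)

/-- Cut at the supremum of the points `u` with `ω s u` at most half the total. The left bound passes
to the supremum by continuity; beyond it `ω s v` exceeds one half, so superadditivity leaves less
than one half for `ω v t`, and `v` decreases to the cut. -/
theorem exists_bisection (h : IsControl ω a b) (has : a ≤ s) (hst : s ≤ t) (htb : t ≤ b) :
    ∃ u, s ≤ u ∧ u ≤ t ∧ ω s u ≤ ω s t / 2 ∧ ω u t ≤ ω s t / 2 := by
  have hW : 0 ≤ ω s t / 2 := by linarith [h.nonneg s t has hst htb]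
  set U : Set ℝ := {u | s ≤ u ∧ u ≤ t ∧ ω s u ≤ ω s t / 2} with hU
  have hsU : s ∈ U := ⟨le_rfl, hst, by rwa [h.self_eq_zero has (hst.trans htb)]⟩
  have hbdd : BddAbove U := ⟨t, fun u hu => hu.2.1⟩
  have hsu : s ≤ sSup U := le_csSup hbdd hsU
  have hut : sSup U ≤ t := csSup_le ⟨s, hsU⟩ fun u hu => hu.2.1
  refine ⟨sSup U, hsu, hut, ?_, ?_⟩
  · rcases hsu.eq_or_lt with hs | hs
    · rw [← hs]
      exact hsU.2.2
    · refine le_of_tendsto (h.tendsto_left s _ has hs (hut.trans htb)) ?_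
      filter_upwards [Ioo_mem_nhdsLT hs] with v hv
      obtain ⟨w, hw, hvw⟩ := exists_lt_of_lt_csSup ⟨s, hsU⟩ hv.2
      have h₁ := h.add_le s v w has hv.1.le hvw.le (hw.2.1.trans htb)
      have h₂ := h.nonneg v w (has.trans hv.1.le) hvw.le (hw.2.1.trans htb)
      linarith [hw.2.2]
  · rcases hut.eq_or_lt with ht | ht
    · rwa [ht, h.self_eq_zero (has.trans hst) htb]
    · refine le_of_tendsto (h.tendsto_right _ t (has.trans hsu) ht htb) ?_
      filter_upwards [Ioo_mem_nhdsGT ht] with v hv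
      have hsv : s ≤ v := hsu.trans hv.1.le
      have h₁ := h.add_le s v t has hsv hv.2.le htb
      have h₂ : ¬ ω s v ≤ ω s t / 2 := fun hle =>
        absurd (le_csSup hbdd (show v ∈ U from ⟨hsv, hv.2.le, hle⟩)) (not_le.2 hv.1)
      linarith

theorem add (h : IsControl ω a b) (h' : IsControl ω' a b) :
    IsControl (fun s t => ω s t + ω' s t) a b where
  nonneg s t h₁ h₂ h₃ := add_nonneg (h.nonneg s t h₁ h₂ h₃) (h'.nonneg s t h₁ h₂ h₃)
  add_le s u t h₁ h₂ h₃ h₄ := by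
    linarith [h.add_le s u t h₁ h₂ h₃ h₄, h'.add_le s u t h₁ h₂ h₃ h₄]
  tendsto_left s t h₁ h₂ h₃ := (h.tendsto_left s t h₁ h₂ h₃).add (h'.tendsto_left s t h₁ h₂ h₃)
  tendsto_right s t h₁ h₂ h₃ := (h.tendsto_right s t h₁ h₂ h₃).add (h'.tendsto_right s t h₁ h₂ h₃)

/-- Superadditivity is the Cauchy–Schwarz inequality in two dimensions. -/
theorem sqrt_mul (h : IsControl ω a b) (h' : IsControl ω' a b) :
    IsControl (fun s t => √(ω s t * ω' s t)) a b where
  nonneg _ _ _ _ _ := Real.sqrt_nonneg _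
  add_le s u t h₁ h₂ h₃ h₄ := by
    have n₁ := h.nonneg s u h₁ h₂ (h₃.trans h₄)
    have n₂ := h.nonneg u t (h₁.trans h₂) h₃ h₄
    have n₃ := h'.nonneg s u h₁ h₂ (h₃.trans h₄)
    have n₄ := h'.nonneg u t (h₁.trans h₂) h₃ h₄
    have key : √(ω s u * ω' s u) + √(ω u t * ω' u t) ≤
        √((ω s u + ω u t) * (ω' s u + ω' u t)) := by
      apply Real.le_sqrt_of_sq_le
      have := sq_nonneg (√(ω s u) * √(ω' u t) - √(ω u t) * √(ω' s u))
      rw [Real.sqrt_mul n₁, Real.sqrt_mul n₂]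
      nlinarith [Real.sq_sqrt n₁, Real.sq_sqrt n₂, Real.sq_sqrt n₃, Real.sq_sqrt n₄,
        mul_pow (√(ω s u)) (√(ω' u t)) 2, mul_pow (√(ω u t)) (√(ω' s u)) 2,
        mul_pow (√(ω s u)) (√(ω' s u)) 2, mul_pow (√(ω u t)) (√(ω' u t)) 2]
    refine key.trans (Real.sqrt_le_sqrt ?_)
    exact mul_le_mul (h.add_le s u t h₁ h₂ h₃ h₄) (h'.add_le s u t h₁ h₂ h₃ h₄) (by positivity)
      (h.nonneg s t h₁ (h₂.trans h₃) h₄)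
  tendsto_left s t h₁ h₂ h₃ :=
    ((h.tendsto_left s t h₁ h₂ h₃).mul (h'.tendsto_left s t h₁ h₂ h₃)).sqrt
  tendsto_right s t h₁ h₂ h₃ :=
    ((h.tendsto_right s t h₁ h₂ h₃).mul (h'.tendsto_right s t h₁ h₂ h₃)).sqrt

theorem const_mul_length {η : ℝ} (hη : 0 ≤ η) : IsControl (fun s t => η * (t - s)) a b where
  nonneg s t _ h₂ _ := mul_nonneg hη (sub_nonneg.2 h₂)
  add_le s u t _ _ _ _ := by linarith
  tendsto_left s t _ _ _ :=
    (Continuous.tendsto (by fun_prop : Continuous fun u : ℝ => η * (u - s)) t).mono_left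
      nhdsWithin_le_nhds
  tendsto_right s t _ _ _ :=
    (Continuous.tendsto (by fun_prop : Continuous fun u : ℝ => η * (t - u)) s).mono_left
      nhdsWithin_le_nhds

/-- The sewing estimate: an almost additive function of intervals is approximated by its sums over
suitable arbitrarily fine partitions. -/
theorem exists_partitionSum_norm_sub_le {G : Type*} [NormedAddCommGroup G] {Ξ : ℝ → ℝ → G}
    {η θ δ K : ℝ} (h : IsControl ω a b) (hη : 0 < η) (hθ : 0 ≤ θ) (hδ : 0 < δ) (hK : 0 ≤ K)
    (hKθ : (2 : ℝ) ^ (1 - θ) * K + 1 ≤ K)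
    (hlen : ∀ s t, a ≤ s → s ≤ t → t ≤ b → η * (t - s) ≤ ω s t)
    (hΞ : ∀ s u t, a ≤ s → s ≤ u → u ≤ t → t ≤ b →
      ‖Ξ s u + Ξ u t - Ξ s t‖ ≤ ω s t ^ θ)
    (has : a ≤ s) (hst : s ≤ t) (htb : t ≤ b) :
    ∃ S, PartitionSum Ξ (fun u v => v - u < δ) s t S ∧ ‖S - Ξ s t‖ ≤ K * ω s t ^ θ := by
  -- `N` counts the bisections: each one halves `ω`, and `ω ≤ ηδ/2` forces length less than `δ`
  -- because `ω` dominates `η` times the length.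
  obtain ⟨N, hN⟩ : ∃ N : ℕ, ω s t ≤ 2 ^ N * (η * δ / 2) := by
    obtain ⟨N, hN⟩ := pow_unbounded_of_one_lt (ω s t / (η * δ / 2)) one_lt_two
    exact ⟨N, ((div_lt_iff₀ (by positivity)).1 hN).le⟩
  induction N generalizing s t with
  | zero =>
    refine ⟨Ξ s t, .single hst ?_, ?_⟩
    · have := hlen s t has hst htb
      have h₂ : η * (t - s) < η * δ := by nlinarith [mul_pos hη hδ]
      exact lt_of_mul_lt_mul_left h₂ hη.le
    · simpa using mul_nonneg hK (Real.rpow_nonneg (h.nonneg s t has hst htb) θ)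
  | succ N ih =>
    obtain ⟨u, hsu, hut, h₁, h₂⟩ := h.exists_bisection has hst htb
    have hN' : ω s t / 2 ≤ 2 ^ N * (η * δ / 2) := by
      rw [pow_succ] at hN
      linarith
    obtain ⟨S, hS, hS'⟩ := ih has hsu (hut.trans htb) (h₁.trans hN')
    obtain ⟨T, hT, hT'⟩ := ih (has.trans hsu) hut htb (h₂.trans hN')
    refine ⟨S + T, hS.trans hT, ?_⟩
    have hW := h.nonneg s t has hst htb
    have e₁ : ω s u ^ θ ≤ (ω s t / 2) ^ θ :=
      Real.rpow_le_rpow (h.nonneg s u has hsu (hut.trans htb)) h₁ hθ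
    have e₂ : ω u t ^ θ ≤ (ω s t / 2) ^ θ :=
      Real.rpow_le_rpow (h.nonneg u t (has.trans hsu) hut htb) h₂ hθ
    -- The two halves together carry `2^{1-θ}` times the error of the whole, so the bound `K`
    -- reproduces itself when `2^{1-θ} K + 1 ≤ K`.
    have e₃ : 2 * (ω s t / 2) ^ θ = 2 ^ (1 - θ) * ω s t ^ θ := by
      rw [Real.div_rpow hW zero_le_two, Real.rpow_sub two_pos, Real.rpow_one]
      ring
    have hsplit : S + T - Ξ s t = (S - Ξ s u) + (T - Ξ u t) + (Ξ s u + Ξ u t - Ξ s t) := by abel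
    calc ‖S + T - Ξ s t‖ ≤ ‖S - Ξ s u‖ + ‖T - Ξ u t‖ + ‖Ξ s u + Ξ u t - Ξ s t‖ := by
          rw [hsplit]
          exact norm_add₃_le
      _ ≤ K * (ω s t / 2) ^ θ + K * (ω s t / 2) ^ θ + ω s t ^ θ := by
          gcongr
          · exact hS'.trans (by gcongr)
          · exact hT'.trans (by gcongr)
          · exact hΞ s u t has hsu hut htb
      _ = (2 ^ (1 - θ) * K + 1) * ω s t ^ θ := by
          linear_combination K * e₃
      _ ≤ K * ω s t ^ θ := by
          gcongr

end IsControl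

theorem isControl_sSup_pVarSums {E : Type*} [NormedAddCommGroup E] {p : ℝ} {x : ℝ → E} {a b : ℝ}
    (hp : 0 < p) (h : BddAbove (pVarSums p x a b)) (hx : ContinuousOn x (Set.Icc a b)) :
    IsControl (fun s t => sSup (pVarSums p x s t)) a b where
  nonneg _ _ _ _ _ := sSup_pVarSums_nonneg
  add_le _ _ _ h₁ h₂ h₃ h₄ := sSup_pVarSums_add_le h h₁ h₂ h₃ h₄
  tendsto_left _ _ h₁ h₂ h₃ := tendsto_sSup_pVarSums_left hp h hx h₁ h₂ h₃
  tendsto_right _ _ h₁ h₂ h₃ := tendsto_sSup_pVarSums_right hp h hx h₁ h₂ h₃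

/-! ### The constant `K` and the Young–Loève estimate -/

theorem two_rpow_one_sub_two_div_lt_one {p : ℝ} (hp1 : 1 < p) (hp2 : p < 2) :
    (2 : ℝ) ^ (1 - 2 / p) < 1 := by
  apply Real.rpow_lt_one_of_one_lt_of_neg one_lt_two
  rw [sub_neg, lt_div_iff₀ (by linarith)]
  linarith

theorem one_le_youngConst {p : ℝ} (hp1 : 1 < p) (hp2 : p < 2) : 1 ≤ youngConst p := by
  have := two_rpow_one_sub_two_div_lt_one hp1 hp2
  have h₂ : (0 : ℝ) < 2 ^ (1 - 2 / p) := by positivity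
  exact (one_le_inv₀ (by linarith)).2 (by linarith)

theorem two_rpow_mul_youngConst_add_one {p : ℝ} (hp1 : 1 < p) (hp2 : p < 2) :
    (2 : ℝ) ^ (1 - 2 / p) * youngConst p + 1 = youngConst p := by
  have := two_rpow_one_sub_two_div_lt_one hp1 hp2
  have h₂ : 1 - (2 : ℝ) ^ (1 - 2 / p) ≠ 0 := by linarith
  unfold youngConst
  generalize (2 : ℝ) ^ (1 - 2 / p) = r at h₂ ⊢
  field_simp
  ring

section YoungLoeve

variable {E F : Type*} [NormedAddCommGroup E] [NormedSpace ℝ E]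
  [NormedAddCommGroup F] [NormedSpace ℝ F]

/-- The left-point Riemann–Stieltjes sums of `Y` against `x` over suitable arbitrarily fine
partitions of `[a, b]` are bounded in norm by any number greater than `M`. -/
def HasFineSumsLE (Y : ℝ → E →L[ℝ] F) (x : ℝ → E) (a b M : ℝ) : Prop :=
  ∀ δ > 0, ∀ ε > 0, ∃ S : F,
    PartitionSum (fun u v => Y u (x v - x u)) (fun u v => v - u < δ) a b S ∧ ‖S‖ ≤ M + ε

variable {Y : ℝ → E →L[ℝ] F} {x : ℝ → E} {a b c M M' p : ℝ}

theorem hasFineSumsLE_self : HasFineSumsLE Y x a a 0 :=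
  fun _ _ _ hε => ⟨0, .nil a, by simpa using hε.le⟩

/-- Replaces the additivity of the integral over adjacent intervals. -/
theorem HasFineSumsLE.trans (h : HasFineSumsLE Y x a b M) (h' : HasFineSumsLE Y x b c M') :
    HasFineSumsLE Y x a c (M + M') := by
  intro δ hδ ε hε
  obtain ⟨S, hS, hSM⟩ := h δ hδ (ε / 2) (half_pos hε)
  obtain ⟨T, hT, hTM⟩ := h' δ hδ (ε / 2) (half_pos hε)
  exact ⟨S + T, hS.trans hT, (norm_add_le S T).trans (by linarith)⟩

theorem HasFineSumsLE.mono (h : HasFineSumsLE Y x a b M) (hM : M ≤ M') :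
    HasFineSumsLE Y x a b M' := fun δ hδ ε hε =>
  let ⟨S, hS, hSM⟩ := h δ hδ ε hε
  ⟨S, hS, by linarith⟩

/-- If the limit exists, the given fine sums approximate it; otherwise the integral is `0` by
convention, and `0 ≤ M` suffices. -/
theorem HasFineSumsLE.norm_youngIntegral_le (h : HasFineSumsLE Y x a b M) (hM : 0 ≤ M) :
    ‖youngIntegral Y x a b‖ ≤ M := by
  unfold youngIntegral
  split_ifs with hI
  · refine le_of_forall_pos_le_add fun ε hε => ?_
    obtain ⟨δ, hδ, H⟩ := hI.choose_spec (ε / 2) (half_pos hε)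
    obtain ⟨S, hS, hSM⟩ := h δ hδ (ε / 2) (half_pos hε)
    obtain ⟨n, τ, hτ, hmesh, rfl⟩ := hS.exists_isPartition
    have h₁ := H n τ hτ hmesh
    have h₂ := norm_sub_norm_le hI.choose
      (∑ i ∈ Finset.range n, Y (τ i) (x (τ (i + 1)) - x (τ i)))
    rw [norm_sub_rev] at h₂
    linarith
  · simpa using hM

/-- The Young–Loève estimate for Riemann–Stieltjes sums. -/
theorem hasFineSumsLE_of_pVar (hp1 : 1 < p) (hp2 : p < 2) (hab : a ≤ b)
    (hY : BddAbove (pVarSums p Y a b)) (hYc : ContinuousOn Y (Set.Icc a b))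
    (hx : BddAbove (pVarSums p x a b)) (hxc : ContinuousOn x (Set.Icc a b)) :
    HasFineSumsLE Y x a b
      (‖Y a (x b - x a)‖ + youngConst p * (pVar p Y a b * pVar p x a b)) := by
  intro δ hδ ε hε
  have hp : 0 < p := by linarith
  -- The geometric mean of the two controls: its power `2/p > 1` is the product of the two
  -- `p`-variations.
  set Z : ℝ → ℝ → ℝ := fun s t => √(sSup (pVarSums p Y s t) * sSup (pVarSums p x s t)) with hZ
  have hZc : IsControl Z a b :=
    (isControl_sSup_pVarSums hp hY hYc).sqrt_mul (isControl_sSup_pVarSums hp hx hxc)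
  have hZp : ∀ s t, Z s t ^ (2 / p) = pVar p Y s t * pVar p x s t := by
    intro s t
    dsimp only [Z]
    rw [Real.sqrt_eq_rpow, ← Real.rpow_mul (mul_nonneg sSup_pVarSums_nonneg sSup_pVarSums_nonneg),
      show 1 / 2 * (2 / p) = 1 / p by field_simp,
      Real.mul_rpow sSup_pVarSums_nonneg sSup_pVarSums_nonneg]
    rfl
  -- `Z` may vanish on long intervals, so `η(t - s)` is added to make a small control force a small
  -- mesh. The cost tends to zero with `η` and is absorbed in `ε`.
  have hlim : Tendsto (fun η : ℝ => youngConst p * (Z a b + η * (b - a)) ^ (2 / p)) (𝓝[>] 0)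
      (𝓝 (youngConst p * (pVar p Y a b * pVar p x a b))) := by
    rw [← hZp]
    have : Continuous fun η : ℝ => youngConst p * (Z a b + η * (b - a)) ^ (2 / p) :=
      continuous_const.mul (Continuous.rpow_const (by fun_prop) fun _ => Or.inr (by positivity))
    simpa using (this.tendsto 0).mono_left (nhdsWithin_le_nhds (s := Set.Ioi 0))
  obtain ⟨η, hη, hη0⟩ := ((hlim.eventually_lt_const (lt_add_of_pos_right _ hε)).and
    self_mem_nhdsWithin).exists
  have hη0 : 0 < η := hη0
  have hΞ : ∀ s u t, a ≤ s → s ≤ u → u ≤ t → t ≤ b →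
      ‖Y s (x u - x s) + Y u (x t - x u) - Y s (x t - x s)‖ ≤
        (Z s t + η * (t - s)) ^ (2 / p) := by
    intro s u t h₁ h₂ h₃ h₄
    have hYb := bddAbove_pVarSums_mono hY h₁ h₄
    have hxb := bddAbove_pVarSums_mono hx h₁ h₄
    have e : Y s (x u - x s) + Y u (x t - x u) - Y s (x t - x s) = (Y u - Y s) (x t - x u) := by
      simp only [map_sub, sub_apply]
      abel
    rw [e]
    calc ‖(Y u - Y s) (x t - x u)‖ ≤ ‖Y u - Y s‖ * ‖x t - x u‖ := ContinuousLinearMap.le_opNorm _ _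
      _ ≤ pVar p Y s t * pVar p x s t := by
          gcongr
          · exact pVar_nonneg
          · exact (norm_sub_le_pVar hp (bddAbove_pVarSums_mono hYb le_rfl h₃) h₂).trans
              (pVar_mono hp hYb le_rfl h₂ h₃)
          · exact (norm_sub_le_pVar hp (bddAbove_pVarSums_mono hxb h₂ le_rfl) h₃).trans
              (pVar_mono hp hxb h₂ h₃ le_rfl)
      _ = Z s t ^ (2 / p) := (hZp s t).symm
      _ ≤ _ := by
          refine Real.rpow_le_rpow (Real.sqrt_nonneg _) ?_ (by positivity)
          exact le_add_of_nonneg_right (mul_nonneg hη0.le (sub_nonneg.2 (h₂.trans h₃)))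
  obtain ⟨S, hS, hSM⟩ := (hZc.add (IsControl.const_mul_length hη0.le)).exists_partitionSum_norm_sub_le
    (Ξ := fun u v => Y u (x v - x u)) (θ := 2 / p) hη0 (by positivity) hδ
    (zero_le_one.trans (one_le_youngConst hp1 hp2)) (two_rpow_mul_youngConst_add_one hp1 hp2).le
    (fun s t h₁ h₂ h₃ => le_add_of_nonneg_left (hZc.nonneg s t h₁ h₂ h₃))
    hΞ le_rfl hab le_rfl
  refine ⟨S, hS, ?_⟩
  have h₁ := norm_sub_norm_le S (Y a (x b - x a))
  linarith

end YoungLoeve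

/-! ### Minkowski's inequality for the `p`-variation -/

theorem IsPartition.mono_le {a b : ℝ} {n : ℕ} {τ : ℕ → ℝ} (h : IsPartition a b n τ) {i j : ℕ}
    (hij : i ≤ j) (hj : j ≤ n) : τ i ≤ τ j := by
  induction j, hij using Nat.le_induction with
  | base => exact le_rfl
  | succ j _ ih => exact (ih (by omega)).trans (h.mono j (by omega))

theorem IsPartition.mem_Icc {a b : ℝ} {n : ℕ} {τ : ℕ → ℝ} (h : IsPartition a b n τ) {i : ℕ}
    (hi : i ≤ n) : τ i ∈ Set.Icc a b :=
  ⟨h.left ▸ h.mono_le (Nat.zero_le i) hi, h.right ▸ h.mono_le hi le_rfl⟩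

/-- The `p`-variation of a path whose increments are dominated by those of `y` plus a Lipschitz
term, on an interval of length at most one. -/
theorem pVar_le_of_norm_sub_le {E F : Type*} [NormedAddCommGroup E] [NormedAddCommGroup F]
    {p a b C L : ℝ} {Y : ℝ → F} {y : ℝ → E} (hp : 1 ≤ p) (hab : a ≤ b) (hab1 : b ≤ a + 1)
    (hC : 0 ≤ C) (hL : 0 ≤ L) (hy : BddAbove (pVarSums p y a b))
    (h : ∀ u v, a ≤ u → u ≤ v → v ≤ b → ‖Y v - Y u‖ ≤ C * ‖y v - y u‖ + L * (v - u)) :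
    BddAbove (pVarSums p Y a b) ∧ pVar p Y a b ≤ C * pVar p y a b + L := by
  have hp0 : 0 < p := by linarith
  have hB : 0 ≤ C * pVar p y a b + L := add_nonneg (mul_nonneg hC pVar_nonneg) hL
  have key : ∀ S ∈ pVarSums p Y a b, S ≤ (C * pVar p y a b + L) ^ p := by
    rintro S ⟨n, τ, hτ, rfl⟩
    have hmono : ∀ i ∈ Finset.range n, 0 ≤ τ (i + 1) - τ i := fun i hi =>
      sub_nonneg.2 (hτ.mono i (Finset.mem_range.1 hi))
    have h₁ : (∑ i ∈ Finset.range n, (C * ‖y (τ (i + 1)) - y (τ i)‖) ^ p) ^ (1 / p) ≤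
        C * pVar p y a b := by
      have : ∑ i ∈ Finset.range n, (C * ‖y (τ (i + 1)) - y (τ i)‖) ^ p =
          C ^ p * ∑ i ∈ Finset.range n, ‖y (τ (i + 1)) - y (τ i)‖ ^ p := by
        rw [Finset.mul_sum]
        exact Finset.sum_congr rfl fun i _ => Real.mul_rpow hC (norm_nonneg _)
      rw [this, Real.mul_rpow (by positivity) (by positivity), ← Real.rpow_mul hC,
        mul_one_div_cancel hp0.ne', Real.rpow_one]
      refine mul_le_mul_of_nonneg_left ?_ hC
      exact Real.rpow_le_rpow (by positivity) (le_csSup hy ⟨n, τ, hτ, rfl⟩) (by positivity)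
    -- The steps have length at most one, so their `p`-th powers are at most the lengths themselves,
    -- which sum to `b - a ≤ 1`.
    have h₂ : (∑ i ∈ Finset.range n, (L * (τ (i + 1) - τ i)) ^ p) ^ (1 / p) ≤ L := by
      have : ∑ i ∈ Finset.range n, (L * (τ (i + 1) - τ i)) ^ p ≤ L ^ p := by
        calc ∑ i ∈ Finset.range n, (L * (τ (i + 1) - τ i)) ^ p
            ≤ ∑ i ∈ Finset.range n, L ^ p * (τ (i + 1) - τ i) := by
              refine Finset.sum_le_sum fun i hi => ?_
              rw [Real.mul_rpow hL (hmono i hi)]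
              gcongr
              have hi' := Finset.mem_range.1 hi
              have h₁ := (hτ.mem_Icc (show i + 1 ≤ n by omega)).2
              have h₂ := (hτ.mem_Icc (show i ≤ n by omega)).1
              simpa using Real.rpow_le_rpow_of_exponent_ge' (hmono i hi) (by linarith) zero_le_one hp
          _ = L ^ p * (b - a) := by
              rw [← Finset.mul_sum, Finset.sum_range_sub, hτ.left, hτ.right]
          _ ≤ L ^ p := mul_le_of_le_one_right (by positivity) (by linarith)
      refine (Real.rpow_le_rpow (Finset.sum_nonneg fun i hi => Real.rpow_nonneg
        (mul_nonneg hL (hmono i hi)) p) this (by positivity)).trans ?_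
      rw [← Real.rpow_mul hL, mul_one_div_cancel hp0.ne', Real.rpow_one]
    have h₃ := Real.Lp_add_le_of_nonneg (Finset.range n) hp
      (f := fun i => C * ‖y (τ (i + 1)) - y (τ i)‖) (g := fun i => L * (τ (i + 1) - τ i))
      (fun i _ => by positivity) (fun i hi => mul_nonneg hL (hmono i hi))
    have hnn : 0 ≤ ∑ i ∈ Finset.range n,
        (C * ‖y (τ (i + 1)) - y (τ i)‖ + L * (τ (i + 1) - τ i)) ^ p :=
      Finset.sum_nonneg fun i hi => Real.rpow_nonneg
        (add_nonneg (by positivity) (mul_nonneg hL (hmono i hi))) p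
    calc ∑ i ∈ Finset.range n, ‖Y (τ (i + 1)) - Y (τ i)‖ ^ p
        ≤ ∑ i ∈ Finset.range n,
          (C * ‖y (τ (i + 1)) - y (τ i)‖ + L * (τ (i + 1) - τ i)) ^ p := by
          refine Finset.sum_le_sum fun i hi => ?_
          have hi' := Finset.mem_range.1 hi
          exact Real.rpow_le_rpow (norm_nonneg _) (h _ _ (hτ.mem_Icc (by omega)).1 (hτ.mono i hi')
            (hτ.mem_Icc (by omega)).2) hp0.le
      _ = ((∑ i ∈ Finset.range n,
          (C * ‖y (τ (i + 1)) - y (τ i)‖ + L * (τ (i + 1) - τ i)) ^ p) ^ (1 / p)) ^ p := by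
          rw [← Real.rpow_mul hnn, one_div_mul_cancel hp0.ne', Real.rpow_one]
      _ ≤ _ := Real.rpow_le_rpow (Real.rpow_nonneg hnn _) (h₃.trans (add_le_add h₁ h₂)) hp0.le
  refine ⟨⟨_, key⟩, ?_⟩
  have := Real.rpow_le_rpow sSup_pVarSums_nonneg (csSup_le (pVarSums_nonempty hab) key)
    (by positivity : 0 ≤ 1 / p)
  rwa [← Real.rpow_mul hB, mul_one_div_cancel hp0.ne', Real.rpow_one] at this

theorem LipschitzWith.norm_le_mul_norm_add {E F : Type*} [NormedAddCommGroup E]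
    [NormedAddCommGroup F] {C : ℝ≥0} {f : E → F} (hf : LipschitzWith C f) (v : E) :
    ‖f v‖ ≤ C * ‖v‖ + ‖f 0‖ := by
  have h₁ := hf.norm_sub_le v 0
  have h₂ := norm_sub_norm_le (f v) (f 0)
  rw [sub_zero] at h₁
  linarith

/-! ### The semigroup and the convolution integral -/

section Semigroup

variable {d m : ℕ} {A : EuclideanSpace ℝ (Fin d) →L[ℝ] EuclideanSpace ℝ (Fin d)}

theorem hasDerivAt_semigroup (t : ℝ) : HasDerivAt (semigroup A) (A * semigroup A t) t :=
  hasDerivAt_exp_smul_const' A t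

theorem continuous_semigroup : Continuous (semigroup A) :=
  continuous_iff_continuousAt.2 fun t => (hasDerivAt_semigroup t).continuousAt

variable {CA lamA : ℝ}

theorem norm_semigroup_le_of_le (hCA : 0 ≤ CA) (hlamA : 0 ≤ lamA)
    (hA : ∀ t : ℝ, 0 ≤ t → ‖semigroup A t‖ ≤ CA * Real.exp (-lamA * t)) {r s : ℝ} (hr : 0 ≤ r)
    (hrs : r ≤ s) : ‖semigroup A s‖ ≤ CA * Real.exp (-lamA * r) := by
  refine (hA s (hr.trans hrs)).trans (mul_le_mul_of_nonneg_left (Real.exp_le_exp.2 ?_) hCA)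
  nlinarith

/-- Mean value inequality on `[r, ∞)`, where the derivative `AΦ(u)` has norm at most `‖A‖ C_A
e^{-λ_A r}`. -/
theorem norm_semigroup_sub_le (hCA : 0 ≤ CA) (hlamA : 0 ≤ lamA)
    (hA : ∀ t : ℝ, 0 ≤ t → ‖semigroup A t‖ ≤ CA * Real.exp (-lamA * t)) {r s t : ℝ} (hr : 0 ≤ r)
    (hrs : r ≤ s) (hst : s ≤ t) :
    ‖semigroup A s - semigroup A t‖ ≤ CA * Real.exp (-lamA * r) * ‖A‖ * (t - s) := by
  have := (convex_Ici r).norm_image_sub_le_of_norm_hasDerivWithin_le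
    (f := semigroup A) (C := CA * Real.exp (-lamA * r) * ‖A‖)
    (fun u _ => (hasDerivAt_semigroup u).hasDerivWithinAt)
    (fun u hu => ?_) (Set.mem_Ici.2 hrs) (Set.mem_Ici.2 (hrs.trans hst))
  · rwa [norm_sub_rev, Real.norm_of_nonneg (sub_nonneg.2 hst)] at this
  · rw [mul_comm _ ‖A‖]
    exact (norm_mul_le _ _).trans (mul_le_mul_of_nonneg_left
      (norm_semigroup_le_of_le hCA hlamA hA hr hu) (norm_nonneg _))

variable {p : ℝ}
  {g : EuclideanSpace ℝ (Fin d) → EuclideanSpace ℝ (Fin m) →L[ℝ] EuclideanSpace ℝ (Fin d)}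
  {Cg : ℝ≥0} {x : ℝ → EuclideanSpace ℝ (Fin m)} {y : ℝ → EuclideanSpace ℝ (Fin d)}

/-- The integrand varies through `g(y)`, giving `D C_g |||y|||`, and through the semigroup, giving
`D‖A‖G`. The Young–Loève estimate combines these with the left-point term. -/
theorem hasFineSumsLE_convolution (hp1 : 1 < p) (hp2 : p < 2) (hg : LipschitzWith Cg g)
    (hCA : 0 ≤ CA) (hlamA : 0 ≤ lamA)
    (hA : ∀ t : ℝ, 0 ≤ t → ‖semigroup A t‖ ≤ CA * Real.exp (-lamA * t))
    {a b c t : ℝ} (hab : a ≤ b) (hbc : b ≤ c) (hca : c = a + 1) (hbt : b ≤ t)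
    (hx : BddAbove (pVarSums p x a c)) (hxc : ContinuousOn x (Set.Icc a c))
    (hy : BddAbove (pVarSums p y a c)) (hyc : ContinuousOn y (Set.Icc a c)) :
    HasFineSumsLE (fun s => (semigroup A (t - s)).comp (g (y s))) x a b
      (CA * Real.exp (-lamA * (t - b)) * youngConst p * (1 + ‖A‖) * pVar p x a c *
        (Cg * pVarNorm p y a c + ‖g 0‖)) := by
  have hp0 : 0 < p := by linarith
  set D := CA * Real.exp (-lamA * (t - b)) with hD
  have hD0 : 0 ≤ D := by positivity
  set G := Cg * pVarNorm p y a c + ‖g 0‖ with hG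
  have hgG : ∀ u, a ≤ u → u ≤ b → ‖g (y u)‖ ≤ G := fun u hau hub =>
    (hg.norm_le_mul_norm_add _).trans (add_le_add_left (mul_le_mul_of_nonneg_left
      (norm_le_pVarNorm hp0 hy hau (hub.trans hbc)) Cg.2) _)
  have hG0 : 0 ≤ G := (norm_nonneg _).trans (hgG a le_rfl hab)
  have hsub : Set.Icc a b ⊆ Set.Icc a c := Set.Icc_subset_Icc_right hbc
  have hyb := bddAbove_pVarSums_mono hy le_rfl hbc
  have hxb := bddAbove_pVarSums_mono hx le_rfl hbc
  obtain ⟨hYb, hYv⟩ := pVar_le_of_norm_sub_le (y := y)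
    (Y := fun s => (semigroup A (t - s)).comp (g (y s))) (C := D * Cg) (L := D * ‖A‖ * G)
    hp1.le hab (hbc.trans hca.le) (by positivity) (by positivity) hyb (fun u v hau huv hvb => by
      have e : (semigroup A (t - v)).comp (g (y v)) - (semigroup A (t - u)).comp (g (y u)) =
          (semigroup A (t - v)).comp (g (y v) - g (y u)) +
            (semigroup A (t - v) - semigroup A (t - u)).comp (g (y u)) := by
        rw [ContinuousLinearMap.comp_sub, ContinuousLinearMap.sub_comp]
        abel
      rw [e]
      refine (norm_add_le _ _).trans (add_le_add ?_ ?_)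
      · refine (ContinuousLinearMap.opNorm_comp_le _ _).trans ?_
        rw [mul_assoc]
        exact mul_le_mul (norm_semigroup_le_of_le hCA hlamA hA (by linarith) (by linarith))
          (hg.norm_sub_le _ _) (norm_nonneg _) hD0
      · refine (ContinuousLinearMap.opNorm_comp_le _ _).trans ?_
        have h₁ := norm_semigroup_sub_le hCA hlamA hA (r := t - b) (s := t - v) (t := t - u)
          (by linarith) (by linarith) (by linarith)
        rw [show t - u - (t - v) = v - u by ring] at h₁
        calc _ ≤ D * ‖A‖ * (v - u) * G :=
              mul_le_mul h₁ (hgG u hau (huv.trans hvb)) (norm_nonneg _)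
                ((norm_nonneg _).trans h₁)
          _ = _ := by ring)
  have hYc : ContinuousOn (fun s => (semigroup A (t - s)).comp (g (y s))) (Set.Icc a b) :=
    ((continuous_semigroup.comp (continuous_const.sub continuous_id)).continuousOn).clm_comp
      (hg.continuous.comp_continuousOn (hyc.mono hsub))
  refine (hasFineSumsLE_of_pVar hp1 hp2 hab hYb hYc hxb (hxc.mono hsub)).mono ?_
  have hK := one_le_youngConst hp1 hp2
  have hxv : pVar p x a b ≤ pVar p x a c := pVar_mono hp0 hx le_rfl hab hbc
  have hyv : pVar p y a b ≤ pVar p y a c := pVar_mono hp0 hy le_rfl hab hbc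
  have hx0 : 0 ≤ pVar p x a b := pVar_nonneg
  have hx0' : 0 ≤ pVar p x a c := pVar_nonneg
  -- The left-point term carries no factor `K`; `1 ≤ K` lets it share the one in front of the
  -- remainder.
  have h₁ : ‖((semigroup A (t - a)).comp (g (y a))) (x b - x a)‖ ≤
      youngConst p * (D * (Cg * ‖y a‖ + ‖g 0‖) * pVar p x a c) := by
    have h₂ : ‖(semigroup A (t - a)).comp (g (y a))‖ ≤ D * (Cg * ‖y a‖ + ‖g 0‖) :=
      (ContinuousLinearMap.opNorm_comp_le _ _).trans (mul_le_mul
        (norm_semigroup_le_of_le hCA hlamA hA (by linarith) (by linarith))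
        (hg.norm_le_mul_norm_add _) (norm_nonneg _) hD0)
    refine ((ContinuousLinearMap.le_opNorm _ _).trans (mul_le_mul h₂
      ((norm_sub_le_pVar hp0 hxb hab).trans hxv) (norm_nonneg _) (by positivity))).trans ?_
    exact le_mul_of_one_le_left (by positivity) hK
  have h₃ : pVar p (fun s => (semigroup A (t - s)).comp (g (y s))) a b * pVar p x a b ≤
      (D * Cg * pVar p y a c + D * ‖A‖ * G) * pVar p x a c := by
    have h₀ : D * Cg * pVar p y a b ≤ D * Cg * pVar p y a c :=
      mul_le_mul_of_nonneg_left hyv (by positivity)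
    exact mul_le_mul (hYv.trans (by linarith)) hxv hx0
      (add_nonneg (mul_nonneg (by positivity) pVar_nonneg) (by positivity))
  -- The value at `a` and the variation of `y` add up to `G`; with `‖A‖G` from the semigroup this
  -- gives the factor `1 + ‖A‖`.
  calc _ ≤ youngConst p * (D * (Cg * ‖y a‖ + ‖g 0‖) * pVar p x a c) +
        youngConst p * ((D * Cg * pVar p y a c + D * ‖A‖ * G) * pVar p x a c) :=
        add_le_add h₁ (mul_le_mul_of_nonneg_left h₃ (by linarith))
    _ = _ := by
        rw [hG, pVarNorm]
        ring

/-- The bound for the convolution integral `∫_0^t Φ(t-s) g(y_s) dx_s`. -/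
theorem norm_youngIntegral_convolution_mul_exp_le (hp1 : 1 < p) (hp2 : p < 2)
    (hg : LipschitzWith Cg g) (hCA : 0 ≤ CA) (hlamA : 0 ≤ lamA)
    (hA : ∀ t : ℝ, 0 ≤ t → ‖semigroup A t‖ ≤ CA * Real.exp (-lamA * t))
    (hx : IsPVarPath p Set.univ x) (hy : IsPVarPath p (Set.Ici 0) y)
    (n : ℕ) {t : ℝ} (ht : t ∈ Set.Icc (n : ℝ) (n + 1)) :
    ‖youngIntegral (fun s => (semigroup A (t - s)).comp (g (y s))) x 0 t‖ * Real.exp (lamA * t) ≤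
      ∑ k ∈ Finset.range (n + 1), Real.exp lamA * youngConst p * CA * (1 + ‖A‖) *
        pVar p x k (k + 1) * Real.exp (lamA * k) * (Cg * pVarNorm p y k (k + 1) + ‖g 0‖) := by
  have hp0 : 0 < p := by linarith
  have hK := one_le_youngConst hp1 hp2
  set c : ℕ → ℝ := fun k => Real.exp lamA * youngConst p * CA * (1 + ‖A‖) *
        pVar p x k (k + 1) * Real.exp (lamA * k) * (Cg * pVarNorm p y k (k + 1) + ‖g 0‖) with hc
  have hc0 : ∀ k, 0 ≤ c k := by
    intro k
    have h₁ : 0 ≤ pVar p x k (k + 1) := pVar_nonneg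
    have h₂ : 0 ≤ pVarNorm p y k (k + 1) := add_nonneg (norm_nonneg _) pVar_nonneg
    have h₃ : 0 ≤ youngConst p := by linarith
    positivity
  have piece : ∀ (k : ℕ) (b : ℝ), (k : ℝ) ≤ b → b ≤ k + 1 → b ≤ t →
      HasFineSumsLE (fun s => (semigroup A (t - s)).comp (g (y s))) x k b
        (c k * Real.exp (-lamA * t)) := by
    intro k b hkb hbk hbt
    have hk : Set.Icc (k : ℝ) (k + 1) ⊆ Set.Ici 0 := fun u hu =>
      (Nat.cast_nonneg k).trans hu.1
    refine (hasFineSumsLE_convolution hp1 hp2 hg hCA hlamA hA hkb hbk rfl hbt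
      (hx.finite_pVar _ _ (by linarith) (Set.subset_univ _)) (hx.continuousOn.mono (Set.subset_univ _))
      (hy.finite_pVar _ _ (by linarith) hk) (hy.continuousOn.mono hk)).mono ?_
    have h₁ : 0 ≤ pVar p x k (k + 1) := pVar_nonneg
    have h₂ : 0 ≤ pVarNorm p y k (k + 1) := add_nonneg (norm_nonneg _) pVar_nonneg
    have h₃ : 0 ≤ youngConst p := by linarith
    -- The factor `e^{λ_A}` is the price of replacing `b` by `k + 1`.
    have h₄ : Real.exp (-lamA * (t - b)) ≤
        Real.exp lamA * Real.exp (lamA * k) * Real.exp (-lamA * t) := by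
      rw [← Real.exp_add, ← Real.exp_add]
      exact Real.exp_le_exp.2 (by nlinarith)
    calc _ ≤ CA * (Real.exp lamA * Real.exp (lamA * k) * Real.exp (-lamA * t)) * youngConst p *
          (1 + ‖A‖) * pVar p x k (k + 1) * (Cg * pVarNorm p y k (k + 1) + ‖g 0‖) := by
          gcongr
      _ = _ := by
          rw [hc]
          ring
  have whole : ∀ k : ℕ, (k : ℝ) ≤ t →
      HasFineSumsLE (fun s => (semigroup A (t - s)).comp (g (y s))) x 0 k
        ((∑ i ∈ Finset.range k, c i) * Real.exp (-lamA * t)) := by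
    intro k
    induction k with
    | zero => intro _; simpa using hasFineSumsLE_self
    | succ k ih =>
      intro hk
      push_cast at hk ⊢
      rw [Finset.sum_range_succ, add_mul]
      exact (ih (by linarith)).trans (piece k (k + 1) (by linarith) le_rfl hk)
  -- The last interval `[n, t]` is incomplete, but is charged the full `c n`.
  have hsum := (whole n ht.1).trans (piece n t ht.1 ht.2 le_rfl)
  rw [← add_mul, ← Finset.sum_range_succ] at hsum
  have := hsum.norm_youngIntegral_le
    (mul_nonneg (Finset.sum_nonneg fun i _ => hc0 i) (Real.exp_nonneg _))
  calc _ ≤ (∑ i ∈ Finset.range (n + 1), c i) * Real.exp (-lamA * t) * Real.exp (lamA * t) :=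
        mul_le_mul_of_nonneg_right this (Real.exp_nonneg _)
    _ = _ := by
        rw [mul_assoc, ← Real.exp_add]
        simp

end Semigroup

/-! ### Gronwall's inequality with jumps, and the theorem -/

/-- Gronwall's inequality on `[0, ∞)` with a forcing term that jumps by `c k` at the integers. -/
theorem mul_exp_neg_le_of_le_integral {u : ℝ → ℝ} {c : ℕ → ℝ} {a q r L : ℝ} (hu : Continuous u)
    (hL : 0 ≤ L) (hrL : r - L ≠ 0)
    (h : ∀ n : ℕ, ∀ t ∈ Set.Icc (n : ℝ) (n + 1),
      u t ≤ a + (∫ s in (0 : ℝ)..t, (q * Real.exp (r * s) + L * u s)) +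
        ∑ k ∈ Finset.range (n + 1), c k)
    (n : ℕ) {t : ℝ} (ht : t ∈ Set.Icc (n : ℝ) (n + 1)) :
    u t * Real.exp (-L * t) ≤ a + q / (r - L) * (Real.exp ((r - L) * t) - 1) +
      ∑ k ∈ Finset.range (n + 1), c k * Real.exp (-L * k) := by
  set v : ℝ → ℝ := fun t => a + ∫ s in (0 : ℝ)..t, (q * Real.exp (r * s) + L * u s) with hv
  have hv' : ∀ t, HasDerivAt v (q * Real.exp (r * t) + L * u t) t := fun t =>
    ((Continuous.integral_hasStrictDerivAt (by fun_prop) 0 t).hasDerivAt).const_add a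
  -- The majorant of `u` times the integrating factor, minus a primitive of `q e^{(r-L)s}`; this
  -- primitive needs `r ≠ L`. What is left of the derivative is nonpositive by the hypothesis on
  -- `u`.
  set w : ℕ → ℝ → ℝ := fun n t => (v t + ∑ k ∈ Finset.range (n + 1), c k) * Real.exp (-L * t) -
    q / (r - L) * Real.exp ((r - L) * t) with hw
  have hw' : ∀ n t, HasDerivAt (w n)
      (L * (u t - (v t + ∑ k ∈ Finset.range (n + 1), c k)) * Real.exp (-L * t)) t := by
    intro n t
    have h₁ : HasDerivAt (fun t => Real.exp (-L * t)) (Real.exp (-L * t) * (-L * 1)) t :=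
      ((hasDerivAt_id t).const_mul (-L)).exp
    have h₂ : HasDerivAt (fun t => Real.exp ((r - L) * t))
        (Real.exp ((r - L) * t) * ((r - L) * 1)) t := ((hasDerivAt_id t).const_mul (r - L)).exp
    refine ((((hv' t).add_const _).mul h₁).sub (h₂.const_mul (q / (r - L)))).congr_deriv ?_
    have h₃ : Real.exp ((r - L) * t) = Real.exp (r * t) * Real.exp (-L * t) := by
      rw [← Real.exp_add]
      ring_nf
    rw [h₃]
    field_simp
    ring
  have hanti : ∀ n : ℕ, AntitoneOn (w n) (Set.Icc (n : ℝ) (n + 1)) := by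
    intro n
    refine antitoneOn_of_deriv_nonpos (convex_Icc _ _)
      (fun t _ => (hw' n t).continuousAt.continuousWithinAt)
      (fun t _ => (hw' n t).differentiableAt.differentiableWithinAt) fun t ht => ?_
    rw [(hw' n t).deriv]
    exact mul_nonpos_of_nonpos_of_nonneg (mul_nonpos_of_nonneg_of_nonpos hL
      (sub_nonpos.2 (h n t (interior_subset ht)))) (Real.exp_nonneg _)
  -- `w` decreases on each unit interval, and passing from `w n` to `w (n + 1)` at `n + 1` adds
  -- exactly the discounted jump.
  have hstart : ∀ n : ℕ, w n n ≤ a - q / (r - L) +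
      ∑ k ∈ Finset.range (n + 1), c k * Real.exp (-L * k) := by
    intro n
    induction n with
    | zero => simp [hw, hv]; linarith
    | succ n ih =>
      have h₁ := hanti n ⟨le_rfl, by linarith⟩ ⟨by linarith, le_rfl⟩
        (show (n : ℝ) ≤ n + 1 by linarith)
      have h₂ : w (n + 1) ((n + 1 : ℕ) : ℝ) =
          w n (n + 1) + c (n + 1) * Real.exp (-L * (n + 1 : ℕ)) := by
        simp only [hw]
        rw [Finset.sum_range_succ _ (n + 1)]
        push_cast
        ring
      rw [h₂, Finset.sum_range_succ _ (n + 1)]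
      linarith
  have h₁ := hanti n ⟨le_rfl, by linarith⟩ ht ht.1
  have h₂ := mul_le_mul_of_nonneg_right (h n t ht) (Real.exp_nonneg (-L * t))
  have h₃ : w n t = (v t + ∑ k ∈ Finset.range (n + 1), c k) * Real.exp (-L * t) -
    q / (r - L) * Real.exp ((r - L) * t) := rfl
  linarith [hstart n]

theorem lemma3 (d m : ℕ) (p : ℝ) (hp1 : 1 < p) (hp2 : p < 2)
    (A : EuclideanSpace ℝ (Fin d) →L[ℝ] EuclideanSpace ℝ (Fin d))
    (f : EuclideanSpace ℝ (Fin d) → EuclideanSpace ℝ (Fin d))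
    (g : EuclideanSpace ℝ (Fin d) → EuclideanSpace ℝ (Fin m) →L[ℝ] EuclideanSpace ℝ (Fin d))
    (Cf Cg : ℝ≥0) (hf : LipschitzWith Cf f) (hg : LipschitzWith Cg g)
    (CA lamA : ℝ) (hCA : 1 ≤ CA) (hlamA : 0 < lamA)
    (hA : ∀ t : ℝ, 0 ≤ t → ‖semigroup A t‖ ≤ CA * Real.exp (-lamA * t))
    (Lf lam : ℝ) (hLf : Lf = CA * Cf) (hlam : lam = lamA - Lf) (hlam0 : lamA - Lf ≠ 0)
    (x : ℝ → EuclideanSpace ℝ (Fin m)) (hx : IsPVarPath p Set.univ x)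
    (y : ℝ → EuclideanSpace ℝ (Fin d)) (hy : IsPVarPath p (Set.Ici 0) y)
    (hyx : SatisfiesVariationOfConstants A f g x y) :
    ∀ n : ℕ, ∀ t ∈ Set.Icc (n : ℝ) (n + 1),
      ‖y t‖ * Real.exp (lam * t) ≤
        CA * ‖y 0‖ + CA / (lamA - Lf) * ‖f 0‖ * (Real.exp (lam * t) - 1)
        + ∑ k ∈ Finset.range (n + 1),
            Real.exp lamA * youngConst p * CA * (1 + ‖A‖) * pVar p x k (k + 1)
              * Real.exp (lam * k) * (Cg * pVarNorm p y k (k + 1) + ‖g 0‖) := by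
  intro n t ht
  have hCA0 : 0 ≤ CA := by linarith
  -- `y` is controlled only on `[0, ∞)`; its constant extension to the left is continuous on the
  -- whole line.
  set z : ℝ → EuclideanSpace ℝ (Fin d) := fun s => y (max s 0) with hz
  have hzc : Continuous z := hy.continuousOn.comp_continuous (by fun_prop) fun s => le_max_right s 0
  have hzy : ∀ s, 0 ≤ s → z s = y s := fun s hs => by rw [hz]; simp [hs]
  have key := mul_exp_neg_le_of_le_integral (u := fun s => ‖z s‖ * Real.exp (lamA * s))
    (c := fun k => Real.exp lamA * youngConst p * CA * (1 + ‖A‖) * pVar p x k (k + 1)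
      * Real.exp (lamA * k) * (Cg * pVarNorm p y k (k + 1) + ‖g 0‖))
    (a := CA * ‖y 0‖) (q := CA * ‖f 0‖) (r := lamA) (L := Lf) (by fun_prop)
    (by rw [hLf]; positivity) hlam0 (fun n t ht => ?_) n ht
  · have ht0 : 0 ≤ t := (Nat.cast_nonneg n).trans ht.1
    have e : ∀ s : ℝ, Real.exp (lamA * s) * Real.exp (-Lf * s) = Real.exp (lam * s) := by
      intro s
      rw [← Real.exp_add, hlam]
      ring_nf
    rw [hzy t ht0, mul_assoc, e, ← hlam] at key
    rw [← hlam]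
    refine key.trans (le_of_eq ?_)
    congr 1
    · ring
    · refine Finset.sum_congr rfl fun k _ => ?_
      rw [← e]
      ring
  · have ht0 : 0 ≤ t := (Nat.cast_nonneg n).trans ht.1
    have hY := norm_youngIntegral_convolution_mul_exp_le hp1 hp2 hg hCA0 hlamA.le hA hx hy n ht
    have h₁ : ‖semigroup A t (y 0)‖ * Real.exp (lamA * t) ≤ CA * ‖y 0‖ := by
      calc _ ≤ CA * Real.exp (-lamA * t) * ‖y 0‖ * Real.exp (lamA * t) := by
            gcongr
            exact ContinuousLinearMap.le_of_opNorm_le _ (hA t ht0) _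
        _ = CA * ‖y 0‖ * (Real.exp (-lamA * t) * Real.exp (lamA * t)) := by ring
        _ = CA * ‖y 0‖ := by
            rw [← Real.exp_add]
            simp
    have h₂ : ‖∫ s in (0 : ℝ)..t, semigroup A (t - s) (f (y s))‖ * Real.exp (lamA * t) ≤
        ∫ s in (0 : ℝ)..t, (CA * ‖f 0‖ * Real.exp (lamA * s) +
          Lf * (‖z s‖ * Real.exp (lamA * s))) := by
      have h₃ : ‖∫ s in (0 : ℝ)..t, semigroup A (t - s) (f (y s))‖ ≤
          ∫ s in (0 : ℝ)..t, (CA * ‖f 0‖ * Real.exp (lamA * s) +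
            Lf * (‖z s‖ * Real.exp (lamA * s))) * Real.exp (-lamA * t) := by
        refine intervalIntegral.norm_integral_le_of_norm_le ht0
          (MeasureTheory.ae_of_all _ fun s hs => ?_)
          (Continuous.intervalIntegrable (by fun_prop) _ _)
        rw [hzy s hs.1.le]
        calc _ ≤ CA * Real.exp (-lamA * (t - s)) * (Cf * ‖y s‖ + ‖f 0‖) :=
              (ContinuousLinearMap.le_of_opNorm_le _ (hA _ (sub_nonneg.2 hs.2)) _).trans (by
                gcongr
                exact hf.norm_le_mul_norm_add _)
          _ = CA * (Real.exp (lamA * s) * Real.exp (-lamA * t)) * (Cf * ‖y s‖ + ‖f 0‖) := by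
              rw [← Real.exp_add]
              ring_nf
          _ = _ := by
              rw [hLf]
              ring
      rw [intervalIntegral.integral_mul_const] at h₃
      calc _ ≤ _ := mul_le_mul_of_nonneg_right h₃ (Real.exp_nonneg _)
        _ = _ := by
            rw [mul_assoc, ← Real.exp_add]
            simp
    rw [hzy t ht0]
    have h₄ : ‖y t‖ ≤ ‖semigroup A t (y 0)‖ +
        ‖∫ s in (0 : ℝ)..t, semigroup A (t - s) (f (y s))‖ +
        ‖youngIntegral (fun s => (semigroup A (t - s)).comp (g (y s))) x 0 t‖ := by
      conv_lhs => rw [hyx t ht0]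
      exact norm_add₃_le
    have h₅ := mul_le_mul_of_nonneg_right h₄ (Real.exp_nonneg (lamA * t))
    rw [add_mul, add_mul] at h₅
    linarith
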